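/- **Setting.** Let $n\ge 2$. For every task sequence $\mathcal T$ there is a finite set of plans, and each plan $p$ has a cost vector $\boldsymbol c(p,\mathcal T)\in\mathbb R^n$. Let $\mathcal W=\{\boldsymbol w\in\mathbb R^n_{\ge0}:\sum_i w_i=1\}$ and fix training instances $\mathcal I=(\mathcal T_1,\dots,\mathcal T_\eta)$. A policy $\pi$ selects for each $\boldsymbol w\in\mathcal W$ and each $\mathcal T_t$ a plan that minimizes $\boldsymbol w\cdot\boldsymbol c(\cdot,\mathcal T_t)$. Write $C(\boldsymbol w)=(\boldsymbol c(\pi(\boldsymbol w),\mathcal T_t))_{t\le\eta}$ and let $\mu(\boldsymbol w)$ be its mean. A *solution* is a tuple $C$ of cost vectors on $\mathcal I$ of a choice of one plan per task sequence; it is optimal for $\boldsymbol w$ if its plans minimize the costs scalarized by $\boldsymbol w$ on every $\mathcal T_t$. Let $\mathcal W(C)\subseteq\mathcal W$ be the set of weights for which $C$ is optimal, and $\Gamma^*$ the set of solutions with $\mathcal W(C)\neq\emptyset$. **Algorithm.** Start with the sampled weights $\Omega=\{\boldsymbol e^1,\dots,\boldsymbol e^n\}$ (standard basis), $\Gamma=\{C(\boldsymbol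 e^1),\dots,C(\boldsymbol e^n)\}$ and the collection of simplexes $\mathcal S=\{\{\boldsymbol e^1,\dots,\boldsymbol e^n\}\}$. An *edge* is an unordered pair of distinct vertices of a simplex in $\mathcal S$. In every iteration select an edge $\{\boldsymbol w^i,\boldsymbol w^j\}$ that maximizes $$D(\{\boldsymbol w^i,\boldsymbol w^j\})=\frac{H_\Delta(\boldsymbol w^i,\boldsymbol w^j)}{2^{\alpha}}\,\|\mu(\boldsymbol w^i)-\mu(\boldsymbol w^j)\|_2 ,$$ where $\alpha$ is the number of earlier selections of an edge with the same unordered pair of mean costs, and $H_\Delta\in\{0,1\}$ is $1$ iff $h=e^{-\mathrm{KL}}$ of the distributions fitted to $C(\boldsymbol w^i)$ and $C(\boldsymbol w^j)$ is at most $\Delta$ (in both orders). Let $\boldsymbol w'$ be the midpoint of the selected edge. Replace every simplex $s\in\mathcal S$ whose convex hull contains $\boldsymbol w'$ by the two simplexes obtained by exchanging for $\boldsymbol w'$ one of the two vertices of $s$ whose midpoint it is. If $h\le\Delta$ between $C(\boldsymbol w')$ and $C(\boldsymbol w)$ for all $\boldsymbol w\in\Omega$, add $\boldsymbol w'$ to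 $\Omega$ and $C(\boldsymbol w')$ to $\Gamma$. Stop when $K$ weights have been solved for. Edges with the same pair of mean costs always tie in $D$; ties may be broken in any way that starves no edge: an edge whose endpoints have different mean costs and which attains the maximum in infinitely many iterations is not passed over forever (for example, the oldest tied edge is taken). **Theorem (Completeness).** Assume that for every $C\in\Gamma^*$ the set $\mathcal W(C)$ contains a ball of positive radius of the $(n-1)$-dimensional hyperplane $\{\sum_i w_i=1\}$. Take $\Delta=1$. Then admissible tie-breaking exists, and for every run with such tie-breaking: 1. There is a finite $K_0\ge n$ such that for every budget $K\ge K_0$ the algorithm returns $\Gamma=\Gamma^*$, and for every $C\in\Gamma^*$ the returned $\Omega$ contains a weight $\boldsymbol w\in\mathcal W(C)$ with $C(\boldsymbol w)=C$. 2. For every edge present at some iteration whose endpoints have different mean costs, its midpoint is returned as the new weight at that or a later iteration. 3. If a simplex $s$ is never split from some iteration on, then all its vertices give one and the same, already sampled, solution $C$; $C$ is optimal for all weights in the convex hull of $s$, and it is the only optimal solution for every weight in the relative interior of $s$. -/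

import Mathlib

open scoped BigOperators

noncomputable section

namespace AdaptiveSampling

/-- Vectors with the Euclidean norm; weights and cost vectors live here. -/
abbrev Vec (n : ℕ) := EuclideanSpace ℝ (Fin n)

/-- The weight space: nonnegative weights that sum to one. -/
def weightSpace (n : ℕ) : Set (Vec n) :=
  {w | (∀ i, 0 ≤ w i) ∧ ∑ i, w i = 1}

/-- The linearly scalarized cost `w · c`. -/
def scalarCost {n : ℕ} (w c : Vec n) : ℝ := ∑ i, w i * c i

/-! ### The planning problem

`𝒯` is the type of task sequences, `Plan T` the set of solutions for the task sequence `T`,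
`cost T p` the vector of the `n` costs of `p`, and `I` lists the `η` training instances.
A selection `x : (T : 𝒯) → Plan T` is what a policy does for one fixed weight. -/

section Problem

variable {n η : ℕ} {𝒯 : Type*} {Plan : 𝒯 → Type*}

/-- `x` solves the scalarized problem with weight `w` on every training instance. -/
def IsOptimal (cost : (T : 𝒯) → Plan T → Vec n) (I : Fin η → 𝒯) (w : Vec n)
    (x : (T : 𝒯) → Plan T) : Prop :=
  ∀ t, ∀ y : Plan (I t), scalarCost w (cost (I t) (x (I t))) ≤ scalarCost w (cost (I t) y)

/-- The cost vectors of `x` on the training instances. -/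
def costSamples (cost : (T : 𝒯) → Plan T → Vec n) (I : Fin η → 𝒯)
    (x : (T : 𝒯) → Plan T) : Fin η → Vec n :=
  fun t => cost (I t) (x (I t))

/-- The set of weights for which the solution with cost vectors `C` is optimal. -/
def optimalRegion (cost : (T : 𝒯) → Plan T → Vec n) (I : Fin η → 𝒯)
    (C : Fin η → Vec n) : Set (Vec n) :=
  {w | w ∈ weightSpace n ∧ ∃ x, IsOptimal cost I w x ∧ costSamples cost I x = C}

/-- The set `Γ*` of all solutions that are optimal for some weight. -/
def optimalSolutions (cost : (T : 𝒯) → Plan T → Vec n) (I : Fin η → 𝒯) :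
    Set (Fin η → Vec n) :=
  {C | (optimalRegion cost I C).Nonempty}

/-- Every optimal solution is optimal on a set of weights that contains a ball of positive radius
of the hyperplane `∑ i, w i = 1`, which has dimension `n - 1`. -/
def RegionsContainBall (cost : (T : 𝒯) → Plan T → Vec n) (I : Fin η → 𝒯) : Prop :=
  ∀ C ∈ optimalSolutions cost I, ∃ w₀ ∈ weightSpace n, ∃ r > 0,
    ∀ w : Vec n, ∑ i, w i = 1 → dist w w₀ < r → w ∈ optimalRegion cost I C

/-- The solver: the policy's cost vectors on the training instances, for the weight `w`. -/
def mrpd (cost : (T : 𝒯) → Plan T → Vec n) (I : Fin η → 𝒯)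
    (policy : Vec n → (T : 𝒯) → Plan T) (w : Vec n) : Fin η → Vec n :=
  costSamples cost I (policy w)

end Problem

/-! ### The algorithm

It sees the problem only through `solver : Vec n → (Fin η → Vec n)`, which returns the `η` sampled
cost vectors for a weight. -/

section Algorithm

variable {n η : ℕ}

/-- Mean of the sampled cost vectors. -/
def meanCost (C : Fin η → Vec n) : Vec n := (η : ℝ)⁻¹ • ∑ t, C t

/-- Error probability `exp (-KL)` of the hypothesis test between two samples; `fit` turns
a sample into a distribution (the empirical one, a fitted Gaussian, ...). -/
def testError (fit : (Fin η → Vec n) → MeasureTheory.ProbabilityMeasure (Vec n))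
    (C C' : Fin η → Vec n) : ℝ :=
  open Classical in
  if InformationTheory.klDiv (fit C : MeasureTheory.Measure (Vec n)) (fit C') = ⊤ then 0
  else Real.exp (-(InformationTheory.klDiv
    (fit C : MeasureTheory.Measure (Vec n)) (fit C')).toReal)

/-- The state of the algorithm. -/
structure State (n η : ℕ) where
  /-- the sampled weights `Ω` -/
  weights : Set (Vec n)
  /-- the sampled costs `Γ` -/
  solutions : Set (Fin η → Vec n)
  /-- the simplexes `S`, each given by its set of vertices -/
  simplices : Set (Set (Vec n))
  /-- the edges that have been selected so far, with repetitions -/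
  selected : List (Sym2 (Vec n))

/-- Unordered pairs of distinct vertices of a common simplex. -/
def State.edges (st : State n η) : Set (Sym2 (Vec n)) :=
  {e | ∃ s ∈ st.simplices, ∃ a ∈ s, ∃ b ∈ s, a ≠ b ∧ e = s(a, b)}

/-- The unordered pair of the mean costs at the two endpoints of an edge. -/
def edgeMeans (solver : Vec n → Fin η → Vec n) (e : Sym2 (Vec n)) : Sym2 (Vec n) :=
  e.map fun w => meanCost (solver w)

/-- The two endpoints of the edge have different mean costs. -/
def Mixed (solver : Vec n → Fin η → Vec n) (e : Sym2 (Vec n)) : Prop :=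
  ¬ (edgeMeans solver e).IsDiag

/-- The midpoint of an edge. -/
def edgeMidpoint (e : Sym2 (Vec n)) : Vec n :=
  Sym2.lift ⟨fun a b => midpoint ℝ a b, fun a b => midpoint_comm a b⟩ e

/-- The distance of the mean costs of the two endpoints of an edge. -/
def pairDispersion (solver : Vec n → Fin η → Vec n) (e : Sym2 (Vec n)) : ℝ :=
  Sym2.lift ⟨fun a b : Vec n => dist a b, fun a b => dist_comm a b⟩ (edgeMeans solver e)

/-- The discount factor: how many of the selected edges had the same pair of mean costs. -/
def discount (solver : Vec n → Fin η → Vec n) (st : State n η) (e : Sym2 (Vec n)) : ℕ :=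
  open Classical in
  st.selected.countP fun f => decide (edgeMeans solver f = edgeMeans solver e)

/-- The cost samples at the two endpoints of the edge pass the test with threshold `Δ`. -/
def PassesTest (fit : (Fin η → Vec n) → MeasureTheory.ProbabilityMeasure (Vec n)) (Δ : ℝ)
    (solver : Vec n → Fin η → Vec n) (e : Sym2 (Vec n)) : Prop :=
  ∀ a b : Vec n, s(a, b) = e → testError fit (solver a) (solver b) ≤ Δ

/-- The discounted pair-wise dispersion of an edge. -/
def discountedDispersion
    (fit : (Fin η → Vec n) → MeasureTheory.ProbabilityMeasure (Vec n)) (Δ : ℝ)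
    (solver : Vec n → Fin η → Vec n) (st : State n η) (e : Sym2 (Vec n)) : ℝ :=
  open Classical in
  (if PassesTest fit Δ solver e then 1 else 0) / 2 ^ discount solver st e
    * pairDispersion solver e

/-- `e` maximizes the discounted pair-wise dispersion among the current edges. -/
def IsMaximizer (fit : (Fin η → Vec n) → MeasureTheory.ProbabilityMeasure (Vec n)) (Δ : ℝ)
    (solver : Vec n → Fin η → Vec n) (st : State n η) (e : Sym2 (Vec n)) : Prop :=
  e ∈ st.edges ∧ ∀ f ∈ st.edges,
    discountedDispersion fit Δ solver st f ≤ discountedDispersion fit Δ solver st e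

/-- The simplexes that replace `s` when it is split at `w'`: if `w'` is the midpoint of two
vertices, each of these two is swapped for `w'` in turn. -/
def splitSimplex (s : Set (Vec n)) (w' : Vec n) : Set (Set (Vec n)) :=
  open Classical in
  if ∃ a ∈ s, ∃ b ∈ s, a ≠ b ∧ midpoint ℝ a b = w' then
    {t | ∃ a ∈ s, ∃ b ∈ s, a ≠ b ∧ midpoint ℝ a b = w' ∧ t = (s \ {a}) ∪ {w'}}
  else {s}

/-- The update step for the selected edge `e`: every simplex that contains the new weight, the
midpoint of `e`, is split, and the new weight is added to the samples if it passes the test against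
all of them. -/
def update (fit : (Fin η → Vec n) → MeasureTheory.ProbabilityMeasure (Vec n)) (Δ : ℝ)
    (solver : Vec n → Fin η → Vec n) (st : State n η) (e : Sym2 (Vec n)) : State n η where
  weights := {w | w ∈ st.weights ∨ (w = edgeMidpoint e ∧
    ∀ v ∈ st.weights, testError fit (solver (edgeMidpoint e)) (solver v) ≤ Δ)}
  solutions := {C | C ∈ st.solutions ∨ (C = solver (edgeMidpoint e) ∧
    ∀ v ∈ st.weights, testError fit (solver (edgeMidpoint e)) (solver v) ≤ Δ)}
  simplices := {t | ∃ s ∈ st.simplices,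
    (edgeMidpoint e ∉ convexHull ℝ s ∧ t = s) ∨
    (edgeMidpoint e ∈ convexHull ℝ s ∧ t ∈ splitSimplex s (edgeMidpoint e))}
  selected := e :: st.selected

/-- The vertices of the initial simplex: the standard basis weights. -/
def basisWeights (n : ℕ) : Set (Vec n) :=
  Set.range fun i : Fin n => EuclideanSpace.single i (1 : ℝ)

/-- The initial state. -/
def initialState (solver : Vec n → Fin η → Vec n) : State n η where
  weights := basisWeights n
  solutions := solver '' basisWeights n
  simplices := {basisWeights n}
  selected := []

/-- `st k` is the state after `k` passes through the main loop and `sel k` the edge that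
is selected in the next one; any maximizer may be selected. -/
def IsRun (fit : (Fin η → Vec n) → MeasureTheory.ProbabilityMeasure (Vec n)) (Δ : ℝ)
    (solver : Vec n → Fin η → Vec n) (st : ℕ → State n η) (sel : ℕ → Sym2 (Vec n)) : Prop :=
  st 0 = initialState solver ∧
    ∀ k, IsMaximizer fit Δ solver (st k) (sel k) ∧
      st (k + 1) = update fit Δ solver (st k) (sel k)

/-- Ties starve no edge: an edge with different mean costs at its endpoints that attains
the maximum infinitely often is not passed over from some iteration on. -/
def FairTies (fit : (Fin η → Vec n) → MeasureTheory.ProbabilityMeasure (Vec n)) (Δ : ℝ)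
    (solver : Vec n → Fin η → Vec n) (st : ℕ → State n η) (sel : ℕ → Sym2 (Vec n)) : Prop :=
  ∀ e, Mixed solver e →
    (∃ᶠ j in Filter.atTop, IsMaximizer fit Δ solver (st j) e) → ∀ k, ∃ j ≥ k, sel j = e

/-- The state in which the algorithm stops for the budget `K ≥ n`: the `n` basis weights and
`K - n` further weights have been solved for. -/
def output (st : ℕ → State n η) (K : ℕ) : State n η := st (K - n)

end Algorithm

end AdaptiveSampling

end

/-! At threshold 1 every test passes, so an edge is ranked by its dispersion alone, halved each time
its pair of means has been selected. `Γ*` is finite and `meanCost` separates its elements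
(`meanCost_injOn`), so only finitely many pairs occur. Suppose an edge with different means is never
bisected. If its pair recurred only finitely often, its value would stay above a positive constant,
while by pigeonhole some selected pair has been discounted below that constant
(`IsRun.infinite_edgeMeans_eq`). So the pair recurs infinitely often, the edge ties for the maximum
each time, and fairness selects it. Hence a simplex that is never split carries one solution.

Now suppose a solution is never sampled, and take a ball of weights on which it is the only optimal
one (`eq_of_mem_ball`). A face whose vertices share a solution has that solution optimal on its
whole hull, hence misses the ball; so a face that meets the ball has an edge that must be bisected.
Edges are chosen by cost and not by length, so diameters need not shrink, but volumes do. The proof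
of `IsRun.notMem_weightBall_of_not_sampled` is by induction on the number of vertices: if no smaller
face meets the ball, a face that does contains the whole slice of the ball by its affine span. Fix
as many independent points of the slice as the face has vertices. Passing to the half that contains
them doubles the determinant of their barycentric coordinates, which is bounded because the
coordinates are nonnegative with sum one.

A fair run exists because all vertices are rational: edges can be numbered, and the maximizer with
least number plus count of earlier selections is taken. -/

namespace AdaptiveSampling

/-! ### Scalarized costs and the weight simplex -/

section ScalarCost

variable {n : ℕ}

/-- The scalarized cost as a linear functional of the weight. -/
def scalarization (c : Vec n) : Vec n →ₗ[ℝ] ℝ where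
  toFun w := scalarCost w c
  map_add' v w := by simp [scalarCost, add_mul, Finset.sum_add_distrib]
  map_smul' a w := by simp [scalarCost, mul_assoc, Finset.mul_sum]

lemma scalarization_apply (c w : Vec n) : scalarization c w = scalarCost w c := rfl

/-- The sum of the coordinates of a vector. -/
def coordSum : Vec n →ₗ[ℝ] ℝ where
  toFun w := ∑ i, w i
  map_add' v w := by simp [Finset.sum_add_distrib]
  map_smul' a w := by simp [Finset.mul_sum]

lemma coordSum_apply (w : Vec n) : coordSum w = ∑ i, w i := rfl

lemma scalarCost_sub (w c d : Vec n) :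
    scalarCost w (c - d) = scalarCost w c - scalarCost w d := by
  simp [scalarCost, mul_sub, Finset.sum_sub_distrib]

lemma scalarCost_single (i : Fin n) (c : Vec n) :
    scalarCost (EuclideanSpace.single i 1) c = c i := by
  simp [scalarCost]

lemma scalarCost_sum {η : ℕ} (w : Vec n) (C : Fin η → Vec n) :
    scalarCost w (∑ t, C t) = ∑ t, scalarCost w (C t) := by
  simp only [scalarCost, WithLp.ofLp_sum, Finset.sum_apply, Finset.mul_sum]
  exact Finset.sum_comm

lemma eq_zero_of_scalarCost_eq_zero {s : Set (Vec n)} (hs : Submodule.span ℝ s = ⊤) {d : Vec n}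
    (hd : ∀ v ∈ s, scalarCost v d = 0) : d = 0 := by
  have h : scalarization d = 0 := LinearMap.ext_on hs fun v hv => hd v hv
  ext i
  rw [← scalarCost_single, ← scalarization_apply, h]
  rfl

lemma basisWeights_eq_range :
    basisWeights n = Set.range (EuclideanSpace.basisFun (Fin n) ℝ).toBasis := by
  ext v
  simp [basisWeights]

lemma span_basisWeights : Submodule.span ℝ (basisWeights n) = ⊤ := by
  rw [basisWeights_eq_range]
  exact (EuclideanSpace.basisFun (Fin n) ℝ).toBasis.span_eq

lemma linearIndepOn_basisWeights : LinearIndepOn ℝ id (basisWeights n) := by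
  rw [basisWeights_eq_range]
  exact (EuclideanSpace.basisFun (Fin n) ℝ).toBasis.linearIndependent.linearIndepOn_id

lemma coordSum_eq_one {w : Vec n} (hw : w ∈ weightSpace n) : coordSum w = 1 := hw.2

lemma convex_weightSpace : Convex ℝ (weightSpace n) := by
  intro v hv w hw a b ha hb hab
  refine ⟨fun i => ?_, ?_⟩
  · have h1 := mul_nonneg ha (hv.1 i)
    have h2 := mul_nonneg hb (hw.1 i)
    simpa using add_nonneg h1 h2
  · have : coordSum (a • v + b • w) = 1 := by
      simp [coordSum_eq_one hv, coordSum_eq_one hw, hab]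
    exact this

lemma basisWeights_subset : basisWeights n ⊆ weightSpace n := by
  rintro _ ⟨i, rfl⟩
  refine ⟨fun j => ?_, by simp⟩
  by_cases h : j = i <;> simp [h]

lemma eq_sum_smul_basisWeight (w : Vec n) :
    w = ∑ i, w i • EuclideanSpace.single i (1 : ℝ) := by
  ext j
  simp [Pi.single_apply]

lemma midpoint_mem_weightSpace {a b : Vec n} (ha : a ∈ weightSpace n) (hb : b ∈ weightSpace n) :
    midpoint ℝ a b ∈ weightSpace n :=
  convex_weightSpace.segment_subset ha hb (midpoint_mem_segment a b)

end ScalarCost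

/-! ### Regions of optimality -/

section Problem

variable {n η : ℕ} {𝒯 : Type*} {Plan : 𝒯 → Type*}
  {cost : (T : 𝒯) → Plan T → Vec n} {I : Fin η → 𝒯}

lemma mem_optimalRegion_iff {C : Fin η → Vec n} {w : Vec n} :
    w ∈ optimalRegion cost I C ↔ w ∈ weightSpace n ∧ (∃ x, costSamples cost I x = C) ∧
      ∀ t, ∀ y : Plan (I t), scalarCost w (C t) ≤ scalarCost w (cost (I t) y) := by
  constructor
  · rintro ⟨hw, x, hx, rfl⟩
    exact ⟨hw, ⟨x, rfl⟩, hx⟩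
  · rintro ⟨hw, ⟨x, rfl⟩, hx⟩
    exact ⟨hw, x, hx, rfl⟩

/-- Membership in the region of `C'` is used only to know that `C'` is attained by some plans and so
competes with `C` at `w`. -/
lemma scalarCost_le_of_mem {C C' : Fin η → Vec n} {v w : Vec n}
    (hw : w ∈ optimalRegion cost I C) (hv : v ∈ optimalRegion cost I C') (t : Fin η) :
    scalarCost w (C t) ≤ scalarCost w (C' t) := by
  obtain ⟨-, -, h⟩ := mem_optimalRegion_iff.1 hw
  obtain ⟨-, ⟨x, rfl⟩, -⟩ := mem_optimalRegion_iff.1 hv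
  exact h t _

lemma convex_optimalRegion (C : Fin η → Vec n) : Convex ℝ (optimalRegion cost I C) := by
  intro v hv w hw a b ha hb hab
  rw [mem_optimalRegion_iff] at *
  refine ⟨convex_weightSpace hv.1 hw.1 ha hb hab, hv.2.1, fun t y => ?_⟩
  simp only [← scalarization_apply, map_add, map_smul, smul_eq_mul]
  exact add_le_add (mul_le_mul_of_nonneg_left (hv.2.2 t y) ha)
    (mul_le_mul_of_nonneg_left (hw.2.2 t y) hb)

/-- In the interior of its region, an optimal solution is the only one. -/
lemma eq_of_mem_ball {C C' : Fin η → Vec n} {w₀ w : Vec n} {r : ℝ}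
    (hC : ∀ w : Vec n, ∑ i, w i = 1 → dist w w₀ < r → w ∈ optimalRegion cost I C)
    (hw : ∑ i, w i = 1) (hwr : dist w w₀ < r) (hC' : w ∈ optimalRegion cost I C') : C' = C := by
  funext t
  rw [← sub_eq_zero]
  have hnonneg : ∀ v : Vec n, ∑ i, v i = 1 → dist v w₀ < r → 0 ≤ scalarCost v (C' t - C t) := by
    intro v hv hvr
    rw [scalarCost_sub, sub_nonneg]
    exact scalarCost_le_of_mem (hC v hv hvr) hC' t
  have h0 : scalarCost w (C' t - C t) = 0 := by
    refine le_antisymm ?_ (hnonneg w hw hwr)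
    rw [scalarCost_sub, sub_nonpos]
    exact scalarCost_le_of_mem hC' (hC w hw hwr) t
  refine eq_zero_of_scalarCost_eq_zero span_basisWeights fun v hv => ?_
  have hv1 : coordSum v = 1 := coordSum_eq_one (basisWeights_subset hv)
  have hw1 : coordSum w = 1 := hw
  have hcont : Continuous fun ε : ℝ => dist (w + ε • (v - w)) w₀ := by fun_prop
  have hev : ∀ᶠ ε in nhds (0 : ℝ), dist (w + ε • (v - w)) w₀ < r :=
    hcont.continuousAt.eventually_lt continuousAt_const (by simpa using hwr)
  obtain ⟨δ, hδ, hδr⟩ := Metric.eventually_nhds_iff.1 hev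
  -- The difference of costs vanishes at `w` and is nonnegative nearby; moving along the line
  -- through `v` in both directions forces it to vanish at `v`.
  have key : ∀ ε : ℝ, |ε| < δ → 0 ≤ ε * scalarCost v (C' t - C t) := by
    intro ε hε
    have := hnonneg (w + ε • (v - w)) (by
      rw [← coordSum_apply]; simp [hv1, hw1]) (hδr (by simpa using hε))
    rw [← scalarization_apply] at this h0 ⊢
    simpa [h0] using this
  have h1 := key (δ / 2) (by rw [abs_of_pos (by linarith)]; linarith)
  have h2 := key (-(δ / 2)) (by rw [abs_neg, abs_of_pos (by linarith)]; linarith)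
  nlinarith

/-- A solution that is optimal at all vertices is the only one that is optimal
at a point of the relative interior. -/
lemma eq_of_mem_intrinsicInterior {s : Set (Vec n)} (hs : Submodule.span ℝ s = ⊤)
    {C C' : Fin η → Vec n} (hC : convexHull ℝ s ⊆ optimalRegion cost I C) {w : Vec n}
    (hw : w ∈ intrinsicInterior ℝ (convexHull ℝ s)) (hC' : w ∈ optimalRegion cost I C') :
    C' = C := by
  funext t
  rw [← sub_eq_zero]
  have hnonneg : ∀ v ∈ convexHull ℝ s, 0 ≤ scalarCost v (C' t - C t) := by
    intro v hv
    rw [scalarCost_sub, sub_nonneg]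
    exact scalarCost_le_of_mem (hC hv) hC' t
  have hwmem := intrinsicInterior_subset hw
  have h0 : scalarCost w (C' t - C t) = 0 := by
    refine le_antisymm ?_ (hnonneg w hwmem)
    rw [scalarCost_sub, sub_nonpos]
    exact scalarCost_le_of_mem hC' (hC hwmem) t
  refine eq_zero_of_scalarCost_eq_zero hs fun v hv => ?_
  have hvmem := subset_convexHull ℝ s hv
  refine le_antisymm ?_ (hnonneg v hvmem)
  obtain ⟨y, hy, rfl⟩ := mem_intrinsicInterior.1 hw
  -- Walking from `y` away from `v` stays in the hull for a short time. The functional is zero at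
  -- `y`, so it is nonnegative there only if it is nonpositive at `v`.
  let f : ℝ → affineSpan ℝ (convexHull ℝ s) := fun ε =>
    ⟨AffineMap.lineMap (y : Vec n) v (-ε),
      AffineMap.lineMap_mem _ y.2 (subset_affineSpan ℝ _ hvmem)⟩
  have hf : Continuous f := by
    refine Continuous.subtype_mk ?_ _
    simp only [AffineMap.lineMap_apply_module]
    fun_prop
  have hf0 : f 0 = y := by ext1; simp [f]
  have hev : ∀ᶠ ε in nhds (0 : ℝ), f ε ∈ interior (Subtype.val ⁻¹' convexHull ℝ s) :=
    hf.continuousAt.eventually_mem (by rw [hf0]; exact isOpen_interior.mem_nhds hy)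
  obtain ⟨δ, hδ, hδr⟩ := Metric.eventually_nhds_iff.1 hev
  have h1 := interior_subset (@hδr (δ / 2) (by
    rw [Real.dist_eq, sub_zero, abs_of_pos (by linarith)]; linarith))
  have h2 := hnonneg _ h1
  rw [← scalarization_apply] at h2 h0 ⊢
  simp only [f, AffineMap.lineMap_apply_module, map_add, map_smul, h0] at h2
  simp only [smul_eq_mul] at h2
  nlinarith

/-- Different optimal solutions have different means. -/
lemma meanCost_injOn (hball : RegionsContainBall cost I) :
    Set.InjOn meanCost (optimalSolutions cost I) := by
  intro C hC C' hC' hmean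
  obtain ⟨w₀, hw₀, r, hr, h⟩ := hball C hC
  obtain ⟨v, hv⟩ := hC'
  have hw₀C := h w₀ hw₀.2 (by simpa using hr)
  -- Without instances the factor `η⁻¹` is zero and cannot be cancelled.
  rcases Nat.eq_zero_or_pos η with rfl | hη
  · exact Subsingleton.elim _ _
  have hsum : ∑ t, C t = ∑ t, C' t :=
    smul_right_injective _ (inv_ne_zero (Nat.cast_ne_zero.2 hη.ne')) hmean
  -- At `w₀` the costs of `C` are at most those of `C'` on each instance, and the sums agree, so all
  -- terms agree. Thus `C'` is optimal at the centre of the ball of `C`.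
  have heq : ∀ t ∈ Finset.univ, scalarCost w₀ (C t) = scalarCost w₀ (C' t) := by
    rw [← Finset.sum_eq_sum_iff_of_le fun t _ => scalarCost_le_of_mem hw₀C hv t,
      ← scalarCost_sum, ← scalarCost_sum, hsum]
  refine (eq_of_mem_ball h hw₀.2 (by simpa using hr) ?_).symm
  refine mem_optimalRegion_iff.2 ⟨hw₀, (mem_optimalRegion_iff.1 hv).2.1, fun t y => ?_⟩
  rw [← heq t (Finset.mem_univ t)]
  exact (mem_optimalRegion_iff.1 hw₀C).2.2 t y

lemma finite_optimalSolutions [∀ T, Finite (Plan T)] : (optimalSolutions cost I).Finite := by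
  refine (Set.Finite.pi fun t => Set.finite_range (cost (I t))).subset ?_
  rintro _ ⟨w, -, x, -, rfl⟩ t -
  exact ⟨x (I t), rfl⟩

lemma mem_optimalRegion_mrpd {policy : Vec n → (T : 𝒯) → Plan T}
    (hpolicy : ∀ w ∈ weightSpace n, IsOptimal cost I w (policy w)) {w : Vec n}
    (hw : w ∈ weightSpace n) : w ∈ optimalRegion cost I (mrpd cost I policy w) :=
  ⟨hw, policy w, hpolicy w hw, rfl⟩

end Problem

/-- If a sequence takes finitely many values on an infinite set of indices, some value has been
taken arbitrarily often before it is taken again at such an index. -/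
lemma exists_le_count {α : Type*} {g : ℕ → α} {c : ℕ → α → ℕ}
    (hc : ∀ j, c (j + 1) (g j) = c j (g j) + 1) (hmono : ∀ q, Monotone fun j => c j q)
    {J : Set ℕ} (hJ : J.Infinite) (hfin : (g '' J).Finite) (N : ℕ) : ∃ j ∈ J, N ≤ c j (g j) := by
  obtain ⟨q, hq⟩ : ∃ q, {j ∈ J | g j = q}.Infinite := by
    by_contra! h
    refine hJ ((hfin.biUnion fun q _ => h q).subset fun j hj => ?_)
    exact Set.mem_biUnion (Set.mem_image_of_mem g hj) ⟨hj, rfl⟩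
  suffices ∃ j ∈ {j ∈ J | g j = q}, N ≤ c j q by
    obtain ⟨j, ⟨hj, rfl⟩, h⟩ := this
    exact ⟨j, hj, h⟩
  induction N with
  | zero => exact hq.nonempty.imp fun j hj => ⟨hj, Nat.zero_le _⟩
  | succ N ih =>
    obtain ⟨j, ⟨-, rfl⟩, h⟩ := ih
    obtain ⟨i, hi, hji⟩ := hq.exists_gt j
    refine ⟨i, hi, ?_⟩
    have h1 := hmono (g j) (Nat.succ_le_of_lt hji)
    have h2 := hc j
    simp only [Nat.succ_eq_add_one] at h1
    omega

end AdaptiveSampling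

/-! ### Invariants of the simplexes and states -/

namespace AdaptiveSampling

variable {n η : ℕ} {fit : (Fin η → Vec n) → MeasureTheory.ProbabilityMeasure (Vec n)}
  {solver : Vec n → Fin η → Vec n}

lemma testError_le_one (C C' : Fin η → Vec n) : testError fit C C' ≤ 1 := by
  unfold testError
  split_ifs
  · exact zero_le_one
  · simp

lemma two_smul_midpoint_sub (a b : Vec n) : (2 : ℝ) • midpoint ℝ a b - b = a := by
  rw [midpoint_eq_smul_add]
  ext i
  simp

/-- Linearly independent vectors do not include the midpoint of two of them. -/
lemma midpoint_notMem_span {s : Set (Vec n)} (hs : LinearIndepOn ℝ id s) {a b : Vec n}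
    (ha : a ∈ s) (hb : b ∈ s) (hab : a ≠ b) : midpoint ℝ a b ∉ Submodule.span ℝ (s \ {a}) := by
  intro h
  have hb' : b ∈ Submodule.span ℝ (s \ {a}) := Submodule.subset_span ⟨hb, hab.symm⟩
  have := Submodule.sub_mem _ (Submodule.smul_mem _ (2 : ℝ) h) hb'
  rw [two_smul_midpoint_sub] at this
  exact hs.notMem_span ha (by simpa using this)

lemma midpoint_notMem {s : Set (Vec n)} (hs : LinearIndepOn ℝ id s) {a b : Vec n}
    (ha : a ∈ s) (hb : b ∈ s) (hab : a ≠ b) : midpoint ℝ a b ∉ s := by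
  intro h
  refine midpoint_notMem_span hs ha hb hab (Submodule.subset_span ⟨h, fun h' => hab ?_⟩)
  exact (midpoint_eq_left_iff ℝ).1 h'

lemma update_weights (st : State n η) (e : Sym2 (Vec n)) :
    (update fit 1 solver st e).weights = insert (edgeMidpoint e) st.weights := by
  ext w
  simp only [update, testError_le_one, implies_true, and_true, Set.mem_ofPred_eq, Set.mem_insert_iff]
  exact or_comm

lemma update_solutions (st : State n η) (e : Sym2 (Vec n)) :
    (update fit 1 solver st e).solutions = insert (solver (edgeMidpoint e)) st.solutions := by
  ext w
  simp only [update, testError_le_one, implies_true, and_true, Set.mem_ofPred_eq, Set.mem_insert_iff]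
  exact or_comm

/-- Vectors with rational coordinates. -/
def rationalVecs (n : ℕ) : Set (Vec n) :=
  Set.range fun q : Fin n → ℚ => WithLp.toLp 2 fun i => (q i : ℝ)

/-- Keeps all vertices in a countable set, which the numbering of edges for fair tie-breaking needs.
-/
lemma midpoint_mem_rationalVecs {a b : Vec n} (ha : a ∈ rationalVecs n)
    (hb : b ∈ rationalVecs n) : midpoint ℝ a b ∈ rationalVecs n := by
  obtain ⟨p, rfl⟩ := ha
  obtain ⟨q, rfl⟩ := hb
  refine ⟨fun i => 2⁻¹ * (p i + q i), ?_⟩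
  rw [midpoint_eq_smul_add]
  ext i
  simp [mul_add]

lemma splitSimplex_nonempty (s : Set (Vec n)) (w : Vec n) : (splitSimplex s w).Nonempty := by
  unfold splitSimplex
  split_ifs with h
  · obtain ⟨a, ha, b, hb, hab, hw⟩ := h
    exact ⟨_, a, ha, b, hb, hab, hw, rfl⟩
  · exact Set.singleton_nonempty s

lemma mem_splitSimplex {s t : Set (Vec n)} {w : Vec n} (ht : t ∈ splitSimplex s w) :
    (t = s ∧ ¬ ∃ a ∈ s, ∃ b ∈ s, a ≠ b ∧ midpoint ℝ a b = w) ∨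
      ∃ a ∈ s, ∃ b ∈ s, a ≠ b ∧ midpoint ℝ a b = w ∧ t = insert w (s \ {a}) := by
  unfold splitSimplex at ht
  split_ifs at ht with h
  · right
    obtain ⟨a, ha, b, hb, hab, hw, rfl⟩ := ht
    exact ⟨a, ha, b, hb, hab, hw, Set.union_singleton⟩
  · exact Or.inl ⟨ht, h⟩

lemma insert_mem_splitSimplex {s : Set (Vec n)} {a b : Vec n} (ha : a ∈ s) (hb : b ∈ s)
    (hab : a ≠ b) : insert (midpoint ℝ a b) (s \ {a}) ∈ splitSimplex s (midpoint ℝ a b) := by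
  unfold splitSimplex
  rw [if_pos ⟨a, ha, b, hb, hab, rfl⟩]
  exact ⟨a, ha, b, hb, hab, rfl, Set.union_singleton.symm⟩

lemma splitSimplex_finite {s : Set (Vec n)} (hs : s.Finite) (w : Vec n) :
    (splitSimplex s w).Finite := by
  refine ((hs.image fun a => insert w (s \ {a})).insert s).subset fun t ht => ?_
  rcases mem_splitSimplex ht with ⟨rfl, -⟩ | ⟨a, ha, b, hb, hab, hw, rfl⟩
  · exact Set.mem_insert _ _
  · exact Set.mem_insert_of_mem _ ⟨a, ha, rfl⟩

/-- What holds for every simplex in a run. -/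
structure IsProperSimplex (s : Set (Vec n)) : Prop where
  finite : s.Finite
  nontrivial : s.Nontrivial
  linearIndepOn : LinearIndepOn ℝ id s
  span_eq_top : Submodule.span ℝ s = ⊤

/-- The exchange is reversible: `a` is twice the midpoint minus `b`, so the span is unchanged, and
the midpoint is outside the span of the remaining vertices. -/
lemma IsProperSimplex.split {s : Set (Vec n)} (hs : IsProperSimplex s) {a b : Vec n}
    (ha : a ∈ s) (hb : b ∈ s) (hab : a ≠ b) :
    IsProperSimplex (insert (midpoint ℝ a b) (s \ {a})) where
  finite := (hs.finite.sdiff).insert _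
  nontrivial := ⟨midpoint ℝ a b, Set.mem_insert _ _, b, Set.mem_insert_of_mem _ ⟨hb, hab.symm⟩,
    fun h => hab ((midpoint_eq_right_iff ℝ).1 h)⟩
  linearIndepOn :=
    (hs.linearIndepOn.mono Set.sdiff_subset).id_insert
      (midpoint_notMem_span hs.linearIndepOn ha hb hab)
  span_eq_top := by
    rw [eq_top_iff, ← hs.span_eq_top, Submodule.span_le]
    intro v hv
    by_cases hva : v = a
    · have hmem : (2 : ℝ) • midpoint ℝ a b - b ∈
          Submodule.span ℝ (insert (midpoint ℝ a b) (s \ {a})) := Submodule.sub_mem _ (Submodule.smul_mem _ _ (Submodule.subset_span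
        (Set.mem_insert _ _))) (Submodule.subset_span (Set.mem_insert_of_mem _ ⟨hb, hab.symm⟩))
      rw [two_smul_midpoint_sub] at hmem
      rwa [hva]
    · exact Submodule.subset_span (Set.mem_insert_of_mem _ ⟨hv, hva⟩)

/-- What holds for every state in a run. -/
structure State.Valid (solver : Vec n → Fin η → Vec n) (st : State n η) : Prop where
  simplices_nonempty : st.simplices.Nonempty
  simplices_finite : st.simplices.Finite
  isProperSimplex : ∀ s ∈ st.simplices, IsProperSimplex s
  subset_weights : ∀ s ∈ st.simplices, s ⊆ st.weights
  weights_subset : st.weights ⊆ weightSpace n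
  weights_rational : st.weights ⊆ rationalVecs n
  solutions_eq : st.solutions = solver '' st.weights

lemma valid_initialState (hn : 2 ≤ n) : (initialState solver).Valid solver where
  simplices_nonempty := Set.singleton_nonempty _
  simplices_finite := Set.finite_singleton _
  isProperSimplex := by
    rintro _ rfl
    refine ⟨Set.finite_range _, ?_, linearIndepOn_basisWeights, span_basisWeights⟩
    have : Nontrivial (Fin n) := Fin.nontrivial_iff_two_le.2 hn
    obtain ⟨i, j, hij⟩ := exists_pair_ne (Fin n)
    refine ⟨_, ⟨i, rfl⟩, _, ⟨j, rfl⟩, fun h => hij ?_⟩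
    exact (EuclideanSpace.basisFun (Fin n) ℝ).toBasis.injective (by simpa using h)
  subset_weights := by
    rintro _ rfl
    exact subset_rfl
  weights_subset := basisWeights_subset
  weights_rational := by
    rintro _ ⟨i, rfl⟩
    refine ⟨Pi.single i 1, ?_⟩
    ext j
    by_cases h : j = i <;> simp [h]
  solutions_eq := rfl

lemma State.Valid.mem_edges {st : State n η} (hst : st.Valid solver) {e : Sym2 (Vec n)}
    (he : e ∈ st.edges) : ∃ s ∈ st.simplices, ∃ a ∈ s, ∃ b ∈ s, a ≠ b ∧ e = s(a, b) ∧
      a ∈ st.weights ∧ b ∈ st.weights := by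
  obtain ⟨s, hs, a, ha, b, hb, hab, rfl⟩ := he
  exact ⟨s, hs, a, ha, b, hb, hab, rfl, hst.subset_weights s hs ha, hst.subset_weights s hs hb⟩

lemma State.Valid.update {st : State n η} (hst : st.Valid solver) {e : Sym2 (Vec n)}
    (he : e ∈ st.edges) : (update fit 1 solver st e).Valid solver := by
  obtain ⟨-, -, a, -, b, -, -, rfl, ha, hb⟩ := hst.mem_edges he
  -- A simplex may be split along another pair `c`, `d` with the same midpoint as the selected edge.
  have hsplit : ∀ t ∈ (AdaptiveSampling.update fit 1 solver st s(a, b)).simplices,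
      t ∈ st.simplices ∨ ∃ s ∈ st.simplices, ∃ c ∈ s, ∃ d ∈ s, c ≠ d ∧
        midpoint ℝ c d = midpoint ℝ a b ∧ t = insert (midpoint ℝ a b) (s \ {c}) := by
    rintro t ⟨s, hs, ⟨-, rfl⟩ | ⟨-, ht⟩⟩
    · exact Or.inl hs
    · rcases mem_splitSimplex ht with ⟨rfl, -⟩ | h
      · exact Or.inl hs
      · exact Or.inr ⟨s, hs, h⟩
  refine ⟨?_, ?_, ?_, ?_, ?_, ?_, ?_⟩
  · obtain ⟨s, hs⟩ := hst.simplices_nonempty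
    by_cases h : edgeMidpoint s(a, b) ∈ convexHull ℝ s
    · obtain ⟨t, ht⟩ := splitSimplex_nonempty s (edgeMidpoint s(a, b))
      exact ⟨t, s, hs, Or.inr ⟨h, ht⟩⟩
    · exact ⟨s, s, hs, Or.inl ⟨h, rfl⟩⟩
  · have := hst.simplices_finite.biUnion fun s hs =>
      (splitSimplex_finite (hst.isProperSimplex s hs).finite (edgeMidpoint s(a, b))).insert s
    refine this.subset ?_
    rintro t ⟨s, hs, ⟨-, rfl⟩ | ⟨-, ht⟩⟩
    · exact Set.mem_biUnion hs (Set.mem_insert _ _)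
    · exact Set.mem_biUnion hs (Set.mem_insert_of_mem _ ht)
  · intro t ht
    rcases hsplit t ht with ht | ⟨s, hs, c, hc, d, hd, hcd, h, rfl⟩
    · exact hst.isProperSimplex t ht
    · rw [← h]
      exact (hst.isProperSimplex s hs).split hc hd hcd
  · intro t ht
    rw [update_weights]
    rcases hsplit t ht with ht | ⟨s, hs, c, hc, d, hd, hcd, h, rfl⟩
    · exact (hst.subset_weights t ht).trans (Set.subset_insert _ _)
    · exact Set.insert_subset_insert (Set.sdiff_subset.trans (hst.subset_weights s hs))
  · rw [update_weights]
    exact Set.insert_subset (midpoint_mem_weightSpace (hst.weights_subset ha)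
      (hst.weights_subset hb)) hst.weights_subset
  · rw [update_weights]
    exact Set.insert_subset (midpoint_mem_rationalVecs (hst.weights_rational ha)
      (hst.weights_rational hb)) hst.weights_rational
  · rw [update_weights, update_solutions, Set.image_insert_eq, hst.solutions_eq]

lemma State.Valid.edges_nonempty {st : State n η} (hst : st.Valid solver) :
    st.edges.Nonempty := by
  obtain ⟨s, hs⟩ := hst.simplices_nonempty
  obtain ⟨a, ha, b, hb, hab⟩ := (hst.isProperSimplex s hs).nontrivial
  exact ⟨s(a, b), s, hs, a, ha, b, hb, hab, rfl⟩

lemma State.Valid.edges_finite {st : State n η} (hst : st.Valid solver) : st.edges.Finite := by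
  have := hst.simplices_finite.biUnion fun s hs =>
    (hst.isProperSimplex s hs).finite.image2 (fun a b => s(a, b)) (hst.isProperSimplex s hs).finite
  refine this.subset ?_
  rintro _ ⟨s, hs, a, ha, b, hb, -, rfl⟩
  exact Set.mem_biUnion hs ⟨a, ha, b, hb, rfl⟩

lemma State.Valid.exists_isMaximizer {st : State n η} (hst : st.Valid solver) :
    ∃ e, IsMaximizer fit 1 solver st e :=
  Set.exists_max_image _ _ hst.edges_finite hst.edges_nonempty

lemma State.Valid.finite_isMaximizer {st : State n η} (hst : st.Valid solver) :
    {e | IsMaximizer fit 1 solver st e}.Finite :=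
  hst.edges_finite.subset fun _ he => he.1

/-! ### Survival and splitting of faces -/

section Run

variable {st : ℕ → State n η} {sel : ℕ → Sym2 (Vec n)}

lemma IsRun.valid (hn : 2 ≤ n) (h : IsRun fit 1 solver st sel) (k : ℕ) :
    (st k).Valid solver := by
  induction k with
  | zero => rw [h.1]; exact valid_initialState hn
  | succ k ih => rw [(h.2 k).2]; exact ih.update (h.2 k).1.1

lemma IsRun.sel_mem (h : IsRun fit 1 solver st sel) (k : ℕ) : sel k ∈ (st k).edges :=
  (h.2 k).1.1

lemma IsRun.monotone_weights (h : IsRun fit 1 solver st sel) :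
    Monotone fun k => (st k).weights := by
  refine monotone_nat_of_le_succ fun k => ?_
  rw [(h.2 k).2, update_weights]
  exact Set.subset_insert _ _

/-- A set of vertices of a simplex stays one as long as none of its edges is bisected. -/
lemma IsRun.face_succ (h : IsRun fit 1 solver st sel) {k : ℕ} {F : Set (Vec n)}
    (hF : ∃ s ∈ (st k).simplices, F ⊆ s)
    (hne : ∀ a ∈ F, ∀ b ∈ F, a ≠ b → edgeMidpoint (sel k) ≠ midpoint ℝ a b) :
    ∃ s ∈ (st (k + 1)).simplices, F ⊆ s := by
  obtain ⟨s, hs, hFs⟩ := hF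
  rw [(h.2 k).2]
  by_cases hw : edgeMidpoint (sel k) ∈ convexHull ℝ s
  · by_cases hex : ∃ a ∈ s, ∃ b ∈ s, a ≠ b ∧ midpoint ℝ a b = edgeMidpoint (sel k)
    · obtain ⟨a, ha, b, hb, hab, hm⟩ := hex
      -- By `hne`, `a` and `b` are not both in `F`; the half that drops a vertex outside `F` still
      -- contains `F`.
      wlog haF : a ∉ F generalizing a b
      · refine this b hb a ha hab.symm (by rw [midpoint_comm, hm]) fun hbF => ?_
        exact hne a (not_not.1 haF) b hbF hab hm.symm
      refine ⟨insert (midpoint ℝ a b) (s \ {a}), ⟨s, hs, Or.inr ⟨hw, ?_⟩⟩, ?_⟩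
      · rw [← hm]
        exact insert_mem_splitSimplex ha hb hab
      · exact fun v hv => Set.mem_insert_of_mem _ ⟨hFs hv, fun hva => haF (hva ▸ hv)⟩
    · refine ⟨s, ⟨s, hs, Or.inr ⟨hw, ?_⟩⟩, hFs⟩
      unfold splitSimplex
      rw [if_neg hex]
      rfl
  · exact ⟨s, ⟨s, hs, Or.inl ⟨hw, rfl⟩⟩, hFs⟩

lemma IsRun.face_of_le (h : IsRun fit 1 solver st sel) {k l : ℕ} (hkl : k ≤ l)
    {F : Set (Vec n)} (hF : ∃ s ∈ (st k).simplices, F ⊆ s)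
    (hne : ∀ j, k ≤ j → j < l →
      ∀ a ∈ F, ∀ b ∈ F, a ≠ b → edgeMidpoint (sel j) ≠ midpoint ℝ a b) :
    ∃ s ∈ (st l).simplices, F ⊆ s := by
  induction l, hkl using Nat.le_induction with
  | base => exact hF
  | succ l hkl ih =>
    exact h.face_succ (ih fun j h1 h2 => hne j h1 (by omega)) (hne l hkl (by omega))

/-- When an edge of a face is bisected, its midpoint replaces either endpoint. -/
lemma IsRun.face_split (h : IsRun fit 1 solver st sel) {k : ℕ} {F : Set (Vec n)}
    (hF : ∃ s ∈ (st k).simplices, F ⊆ s) {a b : Vec n} (ha : a ∈ F) (hb : b ∈ F) (hab : a ≠ b)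
    (hm : edgeMidpoint (sel k) = midpoint ℝ a b) :
    ∃ s ∈ (st (k + 1)).simplices, insert (midpoint ℝ a b) (F \ {a}) ⊆ s := by
  obtain ⟨s, hs, hFs⟩ := hF
  rw [(h.2 k).2]
  refine ⟨insert (midpoint ℝ a b) (s \ {a}), ⟨s, hs, Or.inr ?_⟩,
    Set.insert_subset_insert (Set.sdiff_subset_sdiff_left hFs)⟩
  rw [hm]
  refine ⟨?_, insert_mem_splitSimplex (hFs ha) (hFs hb) hab⟩
  exact (convex_convexHull ℝ s).segment_subset (subset_convexHull ℝ s (hFs ha))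
    (subset_convexHull ℝ s (hFs hb)) (midpoint_mem_segment a b)

/-- A simplex does not survive the bisection of one of its edges. -/
lemma IsRun.notMem_of_split (hn : 2 ≤ n) (h : IsRun fit 1 solver st sel) {k : ℕ}
    {s : Set (Vec n)} (hs : s ∈ (st k).simplices) {a b : Vec n} (ha : a ∈ s) (hb : b ∈ s)
    (hab : a ≠ b) (hm : edgeMidpoint (sel k) = midpoint ℝ a b) :
    s ∉ (st (k + 1)).simplices := by
  rw [(h.2 k).2]
  rintro ⟨t, ht, ⟨hnot, rfl⟩ | ⟨-, hst⟩⟩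
  · refine hnot ?_
    rw [hm]
    exact (convex_convexHull ℝ s).segment_subset (subset_convexHull ℝ s ha)
      (subset_convexHull ℝ s hb) (midpoint_mem_segment a b)
  · rcases mem_splitSimplex hst with ⟨rfl, hex⟩ | ⟨c, -, d, -, -, -, hs'⟩
    · exact hex ⟨a, ha, b, hb, hab, hm.symm⟩
    -- Every half contains the new weight, which an independent set containing `a` and `b` cannot.
    · refine midpoint_notMem ((h.valid hn k).isProperSimplex s hs).linearIndepOn ha hb hab ?_
      rw [hs', ← hm]
      exact Set.mem_insert _ _

end Run

end AdaptiveSampling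

/-! ### Discounting forces every edge with different means to be bisected -/

namespace AdaptiveSampling

variable {n η : ℕ} {fit : (Fin η → Vec n) → MeasureTheory.ProbabilityMeasure (Vec n)}
  {solver : Vec n → Fin η → Vec n} {st : ℕ → State n η} {sel : ℕ → Sym2 (Vec n)}

/-- How many of the selected edges have the value `q` under `φ`. -/
noncomputable def selectedCount {α : Type*} (φ : Sym2 (Vec n) → α) (st : State n η) (q : α) : ℕ :=
  open Classical in st.selected.countP fun f => decide (φ f = q)

lemma IsRun.selectedCount_succ {α : Type*} (φ : Sym2 (Vec n) → α)
    (h : IsRun fit 1 solver st sel) (k : ℕ) (q : α) :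
    selectedCount φ (st (k + 1)) q =
      selectedCount φ (st k) q + open Classical in if φ (sel k) = q then 1 else 0 := by
  rw [(h.2 k).2]
  by_cases hq : φ (sel k) = q <;> simp [selectedCount, update, hq]

lemma IsRun.monotone_selectedCount {α : Type*} (φ : Sym2 (Vec n) → α)
    (h : IsRun fit 1 solver st sel) (q : α) : Monotone fun k => selectedCount φ (st k) q :=
  monotone_nat_of_le_succ fun k => by
    rw [h.selectedCount_succ]
    exact Nat.le_add_right _ _

lemma IsRun.exists_le_selectedCount {α : Type*} (φ : Sym2 (Vec n) → α)
    (h : IsRun fit 1 solver st sel) {J : Set ℕ} (hJ : J.Infinite)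
    (hfin : ((fun j => φ (sel j)) '' J).Finite) (N : ℕ) :
    ∃ j ∈ J, N ≤ selectedCount φ (st j) (φ (sel j)) :=
  exists_le_count (g := fun j => φ (sel j)) (c := fun j q => selectedCount φ (st j) q)
    (fun j => by rw [h.selectedCount_succ, if_pos rfl]) (h.monotone_selectedCount φ) hJ hfin N

lemma discountedDispersion_eq (s : State n η) (e : Sym2 (Vec n)) :
    discountedDispersion fit 1 solver s e =
      pairDispersion solver e / 2 ^ selectedCount (edgeMeans solver) s (edgeMeans solver e) := by
  unfold discountedDispersion
  have hpass : PassesTest fit 1 solver e := fun a b _ => testError_le_one _ _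
  rw [if_pos hpass, one_div, inv_mul_eq_div]
  congr 2
  exact List.countP_congr fun f _ => by simp

lemma pairDispersion_congr {e f : Sym2 (Vec n)} (h : edgeMeans solver e = edgeMeans solver f) :
    pairDispersion solver e = pairDispersion solver f := by
  unfold pairDispersion
  rw [h]

lemma mixed_mk {a b : Vec n} :
    Mixed solver s(a, b) ↔ meanCost (solver a) ≠ meanCost (solver b) := by
  simp [Mixed, edgeMeans]

lemma Mixed.pairDispersion_pos {e : Sym2 (Vec n)} (he : Mixed solver e) :
    0 < pairDispersion solver e := by
  induction e with
  | _ a b => exact dist_pos.2 (mixed_mk.1 he)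

lemma IsRun.finite_edgeMeans (hn : 2 ≤ n) (hfin : (solver '' weightSpace n).Finite)
    (h : IsRun fit 1 solver st sel) : (Set.range fun j => edgeMeans solver (sel j)).Finite := by
  refine (hfin.image2 (fun C C' => s(meanCost C, meanCost C')) hfin).subset ?_
  rintro _ ⟨j, rfl⟩
  have hv := h.valid hn j
  obtain ⟨-, -, a, -, b, -, -, he, ha, hb⟩ := hv.mem_edges (h.sel_mem j)
  refine ⟨solver a, ⟨a, hv.weights_subset ha, rfl⟩, solver b, ⟨b, hv.weights_subset hb, rfl⟩, ?_⟩
  simp [he, edgeMeans]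

/-- An edge with different mean costs that stays forever has the mean costs of infinitely many
of the selected edges. -/
lemma IsRun.infinite_edgeMeans_eq (hn : 2 ≤ n) (hfin : (solver '' weightSpace n).Finite)
    (h : IsRun fit 1 solver st sel) {k : ℕ} {e : Sym2 (Vec n)} (hmix : Mixed solver e)
    (he : ∀ j ≥ k, e ∈ (st j).edges) :
    {j | edgeMeans solver (sel j) = edgeMeans solver e}.Infinite := by
  intro hfinite
  obtain ⟨M, hM⟩ := hfinite.bddAbove
  set c := fun j q => selectedCount (edgeMeans solver) (st j) q with hc
  -- After the last selection of its pair of means, the discount of `e` is frozen.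
  have hbound : ∀ j, c j (edgeMeans solver e) ≤ c (M + 1) (edgeMeans solver e) := by
    intro j
    rcases le_total j (M + 1) with hj | hj
    · exact h.monotone_selectedCount _ _ hj
    · induction j, hj using Nat.le_induction with
      | base => exact le_rfl
      | succ j hj ih =>
        simp only [hc] at ih ⊢
        rw [h.selectedCount_succ, if_neg fun h' => ?_]
        · exact ih
        · have : j ≤ M := hM h'
          omega
  obtain ⟨R, hR⟩ : ∃ R, ∀ j, pairDispersion solver (sel j) ≤ R := by
    obtain ⟨R, hR⟩ := ((h.finite_edgeMeans hn hfin).image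
      (Sym2.lift ⟨fun a b : Vec n => dist a b, fun a b => dist_comm a b⟩)).bddAbove
    exact ⟨R, fun j => hR ⟨_, ⟨j, rfl⟩, rfl⟩⟩
  set δ := pairDispersion solver e / 2 ^ c (M + 1) (edgeMeans solver e) with hδ
  have hδpos : 0 < δ := div_pos hmix.pairDispersion_pos (by positivity)
  -- `N` discounts bring any dispersion, at most `R`, below `δ`. Pigeonhole gives a step at which
  -- the selected pair already has `N` of them, although `e` is present with value at least `δ`.
  obtain ⟨N, hN⟩ := pow_unbounded_of_one_lt (R / δ) (one_lt_two : (1 : ℝ) < 2)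
  obtain ⟨j, hj, hNj⟩ := h.exists_le_selectedCount (edgeMeans solver) (Set.Ici_infinite k)
    ((h.finite_edgeMeans hn hfin).subset (Set.image_subset_range _ _)) N
  have hmax := (h.2 j).1.2 e (he j hj)
  rw [discountedDispersion_eq, discountedDispersion_eq] at hmax
  have h1 : δ ≤ pairDispersion solver e / 2 ^ c j (edgeMeans solver e) :=
    div_le_div_of_nonneg_left hmix.pairDispersion_pos.le (by positivity)
      (pow_le_pow_right₀ one_le_two (hbound j))
  have h2 := h1.trans hmax
  rw [le_div_iff₀ (by positivity)] at h2
  have h3 : (2 : ℝ) ^ N ≤ 2 ^ c j (edgeMeans solver (sel j)) :=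
    pow_le_pow_right₀ one_le_two hNj
  rw [div_lt_iff₀ hδpos] at hN
  have h4 := hR j
  have h5 := mul_le_mul_of_nonneg_left h3 hδpos.le
  linarith

/-- Every edge with different mean costs is bisected. -/
theorem IsRun.exists_edgeMidpoint_eq (hn : 2 ≤ n) (hfin : (solver '' weightSpace n).Finite)
    (h : IsRun fit 1 solver st sel) (hfair : FairTies fit 1 solver st sel) {k : ℕ}
    {e : Sym2 (Vec n)} (he : e ∈ (st k).edges) (hmix : Mixed solver e) :
    ∃ j ≥ k, edgeMidpoint (sel j) = edgeMidpoint e := by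
  by_contra! hne
  have hstay : ∀ j ≥ k, e ∈ (st j).edges := by
    obtain ⟨s, hs, a, ha, b, hb, hab, rfl⟩ := he
    intro j hj
    -- The edge is a face with two vertices, so it persists until its midpoint is selected.
    obtain ⟨t, ht, hsub⟩ := h.face_of_le hj (F := {a, b})
      ⟨s, hs, by rintro _ (rfl | rfl) <;> assumption⟩ (by
        rintro i hi - c (rfl | rfl) d (rfl | rfl) hcd
        · exact absurd rfl hcd
        · exact hne i hi
        · rw [midpoint_comm]
          exact hne i hi
        · exact absurd rfl hcd)
    exact ⟨t, ht, a, hsub (by simp), b, hsub (by simp), hab, rfl⟩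
  -- Equal pairs of means give equal values, so `e` is a maximizer whenever an edge with its pair is
  -- selected.
  have hfreq : ∃ᶠ j in Filter.atTop, IsMaximizer fit 1 solver (st j) e := by
    have hinf := (h.infinite_edgeMeans_eq hn hfin hmix hstay).sdiff (Set.finite_Iio k)
    refine Nat.frequently_atTop_iff_infinite.2 (hinf.mono ?_)
    rintro j ⟨hj, hkj⟩
    refine ⟨hstay j (not_lt.1 hkj), fun f hf => ((h.2 j).1.2 f hf).trans_eq ?_⟩
    rw [discountedDispersion_eq, discountedDispersion_eq, pairDispersion_congr hj, hj]
  obtain ⟨j, hj, hje⟩ := hfair e hmix hfreq k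
  exact hne j hj (by rw [hje])

/-- The vertices of a simplex that is never split have one and the same solution. -/
lemma IsRun.solver_eq_of_forall_mem (hn : 2 ≤ n) (h : IsRun fit 1 solver st sel)
    (hbisect : ∀ k, ∀ e ∈ (st k).edges, Mixed solver e →
      ∃ j ≥ k, edgeMidpoint (sel j) = edgeMidpoint e)
    (hinj : Set.InjOn meanCost (solver '' weightSpace n)) {k : ℕ} {s : Set (Vec n)}
    (hs : ∀ j ≥ k, s ∈ (st j).simplices) {a b : Vec n} (ha : a ∈ s) (hb : b ∈ s) :
    solver a = solver b := by
  by_contra hne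
  have hab : a ≠ b := fun hab => hne (hab ▸ rfl)
  have hv := h.valid hn k
  have hsw := (hv.subset_weights s (hs k le_rfl)).trans hv.weights_subset
  obtain ⟨j, hj, hm⟩ := hbisect k s(a, b) ⟨s, hs k le_rfl, a, ha, b, hb, hab, rfl⟩
    (mixed_mk.2 fun hmean => hne (hinj ⟨a, hsw ha, rfl⟩ ⟨b, hsw hb, rfl⟩ hmean))
  exact h.notMem_of_split hn (hs j hj) ha hb hab hm (hs (j + 1) (hj.le.trans (Nat.le_succ j)))

/-! ### Fair tie-breaking -/

lemma countable_rationalVecs : (rationalVecs n).Countable := Set.countable_range _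

lemma exists_injOn_edges :
    ∃ enc : Sym2 (Vec n) → ℕ, Set.InjOn enc {e | ∀ a ∈ e, a ∈ rationalVecs n} := by
  rw [← Set.countable_iff_exists_injOn]
  refine (countable_rationalVecs.image2 countable_rationalVecs fun a b => s(a, b)).mono ?_
  intro e he
  induction e with
  | _ a b => exact ⟨a, he a (by simp), b, he b (by simp), rfl⟩

/-- A run in which every selected edge has the least number of earlier selections, up to the
initial handicap `enc`, is fair. -/
lemma IsRun.fairTies_of_forall_le (hn : 2 ≤ n) (h : IsRun fit 1 solver st sel)
    {enc : Sym2 (Vec n) → ℕ} (henc : Set.InjOn enc {e | ∀ a ∈ e, a ∈ rationalVecs n})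
    (hsel : ∀ k e, IsMaximizer fit 1 solver (st k) e →
      selectedCount id (st k) (sel k) + enc (sel k) ≤ selectedCount id (st k) e + enc e) :
    FairTies fit 1 solver st sel := by
  intro e _ hfreq k
  by_contra! hne
  -- While `e` is passed over its score stays `B`. Edges preferred to it have a code at most `B`, so
  -- they are finitely many, and one of them is eventually selected more than `B` times.
  set B := selectedCount id (st k) e + enc e with hB
  have hcount : ∀ j ≥ k, selectedCount id (st j) e = selectedCount id (st k) e := by
    intro j hj
    induction j, hj using Nat.le_induction with
    | base => rfl
    | succ j hj ih => rw [h.selectedCount_succ, id, if_neg (hne j hj), ih, add_zero]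
  have hJ := (Nat.frequently_atTop_iff_infinite.1 hfreq).sdiff (Set.finite_Iio k)
  set J := {j | IsMaximizer fit 1 solver (st j) e} \ Set.Iio k
  have hle : ∀ j ∈ J, selectedCount id (st j) (sel j) + enc (sel j) ≤ B := by
    rintro j ⟨hj, hkj⟩
    rw [hB, ← hcount j (not_lt.1 hkj)]
    exact hsel j e hj
  have hfin : ((fun j => id (sel j)) '' J).Finite := by
    refine Set.Finite.of_finite_image ((Set.finite_Iic B).subset ?_) (henc.mono ?_)
    · rintro _ ⟨_, ⟨j, hj, rfl⟩, rfl⟩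
      exact (Nat.le_add_left _ _).trans (hle j hj)
    · rintro _ ⟨j, -, rfl⟩ c hc
      have hv := h.valid hn j
      obtain ⟨-, -, a, -, b, -, -, he, ha, hb⟩ := hv.mem_edges (h.sel_mem j)
      simp only [id, he, Sym2.mem_iff] at hc
      rcases hc with rfl | rfl
      exacts [hv.weights_rational ha, hv.weights_rational hb]
  obtain ⟨j, hj, hBj⟩ := h.exists_le_selectedCount id hJ hfin (B + 1)
  have := hle j hj
  simp only [id] at hBj
  omega

/-- Ties can be broken fairly. -/
theorem exists_isRun_fairTies (hn : 2 ≤ n) :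
    ∃ st sel, IsRun fit 1 solver st sel ∧ FairTies fit 1 solver st sel := by
  obtain ⟨enc, henc⟩ := exists_injOn_edges (n := n)
  have hpick : ∀ s : State n η, ∃ e, s.Valid solver → IsMaximizer fit 1 solver s e ∧
      ∀ f, IsMaximizer fit 1 solver s f →
        selectedCount id s e + enc e ≤ selectedCount id s f + enc f := by
    intro s
    by_cases hs : s.Valid solver
    · obtain ⟨e, he, hmin⟩ := Set.exists_min_image _ (fun e => selectedCount id s e + enc e)
        (hs.finite_isMaximizer (fit := fit)) hs.exists_isMaximizer
      exact ⟨e, fun _ => ⟨he, hmin⟩⟩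
    -- A dummy value; the run never reaches an invalid state.
    · exact ⟨s(0, 0), fun h => absurd h hs⟩
  choose pick hpick using hpick
  let st : ℕ → State n η := fun k =>
    Nat.rec (initialState solver) (fun _ s => update fit 1 solver s (pick s)) k
  have hvalid : ∀ k, (st k).Valid solver := by
    intro k
    induction k with
    | zero => exact valid_initialState hn
    | succ k ih => exact ih.update (hpick _ ih).1.1
  have hrun : IsRun fit 1 solver st fun k => pick (st k) :=
    ⟨rfl, fun k => ⟨(hpick _ (hvalid k)).1, rfl⟩⟩
  exact ⟨st, _, hrun, hrun.fairTies_of_forall_le hn henc fun k => (hpick _ (hvalid k)).2⟩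

end AdaptiveSampling

/-! ### Barycentric coordinates and the volume argument -/

namespace AdaptiveSampling

/-- On the way from nonnegative coordinates to others, one of them vanishes while all of them are
still nonnegative. -/
lemma exists_coord_eq_zero {m : ℕ} {l μ : Fin (m + 1) → ℝ} (hl : ∀ i, 0 ≤ l i)
    (hμ : ¬ ∀ i, 0 ≤ μ i) :
    ∃ s ∈ Set.Icc (0 : ℝ) 1, (∃ i, (1 - s) * l i + s * μ i = 0) ∧
      ∀ i, 0 ≤ (1 - s) * l i + s * μ i := by
  push Not at hμ
  obtain ⟨i₀, hi₀⟩ := hμ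
  let f : Fin (m + 1) → ℝ → ℝ := fun i s => (1 - s) * l i + s * μ i
  -- The least coordinate along the segment; at a zero of it, some coordinate vanishes and none is
  -- negative.
  let g : ℝ → ℝ := Finset.univ.inf' Finset.univ_nonempty f
  have hg : ∀ s, g s = Finset.univ.inf' Finset.univ_nonempty fun i => f i s :=
    fun s => Finset.inf'_apply _ _ _
  have hcont : Continuous g := Continuous.finset_inf' _ fun i _ => by fun_prop
  have h0 : 0 ≤ g 0 := by
    rw [hg]
    exact Finset.le_inf' _ _ fun i _ => by simpa [f] using hl i
  have h1 : g 1 ≤ 0 := by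
    rw [hg]
    refine (Finset.inf'_le _ (Finset.mem_univ i₀)).trans ?_
    simpa [f] using hi₀.le
  obtain ⟨s, hs, hgs⟩ := intermediate_value_Icc' zero_le_one hcont.continuousOn ⟨h1, h0⟩
  refine ⟨s, hs, ?_, fun i => ?_⟩
  · obtain ⟨i, -, hi⟩ := Finset.exists_mem_eq_inf' Finset.univ_nonempty fun i => f i s
    exact ⟨i, by rw [← hgs, hg, hi]⟩
  · rw [← hgs, hg]
    exact Finset.inf'_le (fun i => f i s) (Finset.mem_univ i)

/-- A matrix with equal rows, up to a positive multiple of the identity, is invertible. -/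
lemma det_add_smul_one_ne_zero {m : ℕ} {l : Fin m → ℝ} (hl : ∑ i, l i = 1) {ε : ℝ} (hε : 0 < ε) :
    (Matrix.of fun j i : Fin m => (1 - ε) * l i + if j = i then ε else 0).det ≠ 0 := by
  intro hdet
  obtain ⟨v, hv, hv0⟩ := Matrix.exists_vecMul_eq_zero_iff.2 hdet
  have hcoord : ∀ i, (1 - ε) * l i * ∑ j, v j + ε * v i = 0 := by
    intro i
    have := congrFun hv0 i
    simp only [Matrix.vecMul, dotProduct, Matrix.of_apply, mul_add, Finset.sum_add_distrib,
      mul_ite, mul_zero, Finset.sum_ite_eq', Finset.mem_univ, if_true, Pi.zero_apply,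
      ← Finset.sum_mul] at this
    linarith
  -- Summing over `i` with `∑ l = 1` leaves exactly the sum of the kernel vector.
  have hsum : ∑ j, v j = 0 := by
    have := Finset.sum_eq_zero fun i (_ : i ∈ Finset.univ) => hcoord i
    rw [Finset.sum_add_distrib, ← Finset.sum_mul, ← Finset.mul_sum, ← Finset.mul_sum, hl] at this
    linarith
  refine hv (funext fun i => ?_)
  have := hcoord i
  rw [hsum, mul_zero, zero_add] at this
  exact (mul_eq_zero.1 this).resolve_left hε.ne'

/-- The change of barycentric coordinates when the vertex `a` is replaced by the midpoint
of `a` and `b`. -/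
def bisectCoords {m : ℕ} (a b : Fin m) (l : Fin m → ℝ) : Fin m → ℝ :=
  fun i => if i = a then 2 * l a else if i = b then l b - l a else l i

/-- With `m` the midpoint, `l a • z a + l b • z b = (2 * l a) • m + (l b - l a) • z b`. -/
lemma sum_bisectCoords_smul {m n : ℕ} {a b : Fin m} (hab : a ≠ b) (l : Fin m → ℝ)
    (z : Fin m → Vec n) :
    ∑ i, bisectCoords a b l i • Function.update z a (midpoint ℝ (z a) (z b)) i =
      ∑ i, l i • z i := by
  rw [← sub_eq_zero, ← Finset.sum_sub_distrib, Fintype.sum_eq_add a b hab]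
  · simp only [bisectCoords, if_true, if_neg hab.symm, Function.update_self,
      Function.update_of_ne hab.symm, midpoint_eq_smul_add]
    ext i
    simp
    ring
  · rintro i ⟨hia, hib⟩
    simp [bisectCoords, hia, hib]

/-- Subtracting column `a` from column `b` keeps the determinant; scaling column `a` by 2 doubles
it. -/
lemma det_bisectCoords {m : ℕ} {a b : Fin m} (hab : a ≠ b) (L : Matrix (Fin m) (Fin m) ℝ) :
    (Matrix.of fun j => bisectCoords a b (L j)).det = 2 * L.det := by
  have h : (Matrix.of fun j => bisectCoords a b (L j)) =
      (L.updateCol b fun k => L k b + (-1 : ℝ) • L k a).updateCol a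
        ((2 : ℝ) • fun k => L k a) := by
    ext j i
    by_cases hia : i = a
    · subst hia
      simp [bisectCoords]
    · by_cases hib : i = b
      · subst hib
        simp [bisectCoords, hia, sub_eq_add_neg]
      · simp [bisectCoords, hia, hib]
  have h' : (L.updateCol b fun k => L k b + (-1 : ℝ) • L k a).updateCol a (fun k => L k a) =
      L.updateCol b fun k => L k b + (-1 : ℝ) • L k a := by
    ext j i
    by_cases hia : i = a
    · subst hia
      simp [hab]
    · simp [hia]
  rw [h, Matrix.det_updateCol_smul, h', Matrix.det_updateCol_add_smul_self _ hab.symm]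

variable {n η : ℕ} {fit : (Fin η → Vec n) → MeasureTheory.ProbabilityMeasure (Vec n)}
  {solver : Vec n → Fin η → Vec n} {st : ℕ → State n η} {sel : ℕ → Sym2 (Vec n)}

lemma injective_update_midpoint {m : ℕ} {z : Fin m → Vec n} (hz : Function.Injective z)
    {s : Set (Vec n)} (hs : LinearIndepOn ℝ id s) (hzs : Set.range z ⊆ s) {a b : Fin m}
    (hab : a ≠ b) : Function.Injective (Function.update z a (midpoint ℝ (z a) (z b))) := by
  have hnot : ∀ i, z i ≠ midpoint ℝ (z a) (z b) := fun i hi =>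
    midpoint_notMem hs (hzs ⟨a, rfl⟩) (hzs ⟨b, rfl⟩) (hz.ne hab) (hi ▸ hzs ⟨i, rfl⟩)
  intro i j hij
  by_cases hi : i = a <;> by_cases hj : j = a
  · rw [hi, hj]
  · rw [hi, Function.update_self, Function.update_of_ne hj] at hij
    exact absurd hij.symm (hnot j)
  · rw [hj, Function.update_self, Function.update_of_ne hi] at hij
    exact absurd hij (hnot i)
  · rw [Function.update_of_ne hi, Function.update_of_ne hj] at hij
    exact hz hij

lemma range_update_subset {m : ℕ} {z : Fin m → Vec n} (hz : Function.Injective z) (a : Fin m)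
    (w : Vec n) : Set.range (Function.update z a w) ⊆ insert w (Set.range z \ {z a}) := by
  rintro _ ⟨i, rfl⟩
  by_cases hi : i = a
  · subst hi
    simp
  · rw [Function.update_of_ne hi]
    exact Set.mem_insert_of_mem _ ⟨⟨i, rfl⟩, hz.ne hi⟩

/-- The first bisection of a face at one of its edges. -/
lemma IsRun.exists_first_split (h : IsRun fit 1 solver st sel) {m k : ℕ} {z : Fin m → Vec n}
    (hface : ∃ s ∈ (st k).simplices, Set.range z ⊆ s)
    (hex : ∃ j ≥ k, ∃ a b, a ≠ b ∧ edgeMidpoint (sel j) = midpoint ℝ (z a) (z b)) :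
    ∃ j, (∃ s ∈ (st j).simplices, Set.range z ⊆ s) ∧
      ∃ a b, a ≠ b ∧ edgeMidpoint (sel j) = midpoint ℝ (z a) (z b) := by
  classical
  obtain ⟨hj, hspec⟩ := Nat.find_spec hex
  refine ⟨Nat.find hex, h.face_of_le hj hface ?_, hspec⟩
  rintro i hki hi _ ⟨a, rfl⟩ _ ⟨b, rfl⟩ hab hm
  exact Nat.find_min hex hi ⟨hki, a, b, fun h => hab (h ▸ rfl), hm⟩

/-- The points of the hyperplane of weights that are close to `w₀`. -/
def weightBall (w₀ : Vec n) (r : ℝ) : Set (Vec n) := {w | coordSum w = 1 ∧ dist w w₀ < r}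

lemma convex_weightBall (w₀ : Vec n) (r : ℝ) : Convex ℝ (weightBall w₀ r) := by
  intro v hv w hw a b ha hb hab
  refine ⟨?_, convex_ball w₀ r hv.2 hw.2 ha hb hab⟩
  simp [hv.1, hw.1, hab]

/-- If no facet of a face meets a ball, but the face does, then all points of the ball in the span
of the face belong to the face. -/
lemma coords_nonneg_of_mem_weightBall {m : ℕ} {w₀ : Vec n} {r : ℝ} {z : Fin (m + 1) → Vec n}
    (hfacet : ∀ i : Fin (m + 1), ∀ l : Fin m → ℝ, (∀ j, 0 ≤ l j) →
      ∑ j, l j • z (i.succAbove j) ∉ weightBall w₀ r)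
    {l μ : Fin (m + 1) → ℝ} (hl : ∀ i, 0 ≤ l i) (hlB : ∑ i, l i • z i ∈ weightBall w₀ r)
    (hμB : ∑ i, μ i • z i ∈ weightBall w₀ r) : ∀ i, 0 ≤ μ i := by
  by_contra hμ
  -- The segment between the two points stays in the convex ball and would leave the face through
  -- the facet opposite vertex `i`.
  obtain ⟨s, hs, ⟨i, hi⟩, hnonneg⟩ := exists_coord_eq_zero hl hμ
  refine hfacet i (fun j => (1 - s) * l (i.succAbove j) + s * μ (i.succAbove j))
    (fun j => hnonneg _) ?_
  have hmem := convex_weightBall w₀ r hlB hμB (sub_nonneg.2 hs.2) hs.1 (sub_add_cancel 1 s)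
  convert hmem using 1
  simp only [Finset.smul_sum, smul_smul, ← Finset.sum_add_distrib, ← add_smul]
  rw [Fin.sum_univ_succAbove _ i, hi, zero_smul, zero_add]

/-- The entries lie in `[0, 1]`, so each term of the Leibniz expansion is at most 1 in absolute
value. -/
lemma abs_det_le_factorial {m : ℕ} {L : Matrix (Fin m) (Fin m) ℝ} (hL : ∀ j i, 0 ≤ L j i)
    (hsum : ∀ j, ∑ i, L j i = 1) : |L.det| ≤ m.factorial := by
  have := Matrix.det_le (A := L) (abv := AbsoluteValue.abs) (x := 1) fun j i => by
    rw [AbsoluteValue.abs_apply, abs_of_nonneg (hL j i), ← hsum j]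
    exact Finset.single_le_sum (fun i _ => hL j i) (Finset.mem_univ i)
  simpa using this

/-- If a solution is never sampled, then no face of the simplexes meets a ball on which it is the
only optimal one. -/
theorem IsRun.notMem_weightBall_of_not_sampled (hn : 2 ≤ n) (h : IsRun fit 1 solver st sel)
    {w₀ : Vec n} {r : ℝ}
    (hunmixed : ∀ k, ∀ F : Set (Vec n), (∃ s ∈ (st k).simplices, F ⊆ s) →
      (∀ a ∈ F, ∀ b ∈ F, solver a = solver b) → ∀ w ∈ convexHull ℝ F, w ∉ weightBall w₀ r)
    (hbisect : ∀ k, ∀ a b, a ≠ b → (∃ s ∈ (st k).simplices, a ∈ s ∧ b ∈ s) →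
      solver a ≠ solver b → ∃ j ≥ k, edgeMidpoint (sel j) = midpoint ℝ a b)
    (m : ℕ) : ∀ k, ∀ z : Fin m → Vec n, Function.Injective z →
      (∃ s ∈ (st k).simplices, Set.range z ⊆ s) → ∀ l : Fin m → ℝ, (∀ i, 0 ≤ l i) →
      ∑ i, l i • z i ∉ weightBall w₀ r := by
  induction m with
  | zero =>
    intro k z _ _ l _ hmem
    simpa using hmem.1
  | succ m ih =>
    intro k z hz hface l hl hlB
    have hsum : ∀ k, ∀ z : Fin (m + 1) → Vec n, (∃ s ∈ (st k).simplices, Set.range z ⊆ s) →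
        ∀ l : Fin (m + 1) → ℝ, ∑ i, l i • z i ∈ weightBall w₀ r → ∑ i, l i = 1 := by
      rintro k z ⟨s, hs, hzs⟩ l hlB
      have hv := h.valid hn k
      rw [← hlB.1, map_sum]
      refine Finset.sum_congr rfl fun i _ => ?_
      rw [map_smul, coordSum_eq_one (hv.weights_subset (hv.subset_weights s hs (hzs ⟨i, rfl⟩))),
        smul_eq_mul, mul_one]
    have hnonneg : ∀ k, ∀ z : Fin (m + 1) → Vec n, Function.Injective z →
        (∃ s ∈ (st k).simplices, Set.range z ⊆ s) → ∀ l μ : Fin (m + 1) → ℝ, (∀ i, 0 ≤ l i) →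
        ∑ i, l i • z i ∈ weightBall w₀ r → ∑ i, μ i • z i ∈ weightBall w₀ r →
        ∀ i, 0 ≤ μ i := by
      rintro k z hz ⟨s, hs, hzs⟩ l μ hl hlB hμB
      refine coords_nonneg_of_mem_weightBall (fun i => ?_) hl hlB hμB
      exact ih k (fun j => z (i.succAbove j)) (hz.comp Fin.succAbove_right_injective)
        ⟨s, hs, (Set.range_comp_subset_range _ _).trans hzs⟩
    set p := ∑ i, l i • z i with hp
    -- Moving `p` slightly towards each vertex gives `m + 1` independent points of the ball, which
    -- stay fixed through all bisections.
    obtain ⟨ε, hε, hεr⟩ : ∃ ε > (0 : ℝ), ∀ j, p + ε • (z j - p) ∈ weightBall w₀ r := by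
      have hev : ∀ᶠ ε in nhds (0 : ℝ), ∀ j, dist (p + ε • (z j - p)) w₀ < r := by
        rw [Filter.eventually_all]
        intro j
        have hcont : Continuous fun ε : ℝ => dist (p + ε • (z j - p)) w₀ := by fun_prop
        exact hcont.continuousAt.eventually_lt continuousAt_const (by simpa using hlB.2)
      obtain ⟨δ, hδ, hδr⟩ := Metric.eventually_nhds_iff.1 hev
      refine ⟨δ / 2, by positivity, fun j => ⟨?_, ?_⟩⟩
      · obtain ⟨s, hs, hzs⟩ := hface
        have hv := h.valid hn k
        simp [hlB.1,
          coordSum_eq_one (hv.weights_subset (hv.subset_weights s hs (hzs ⟨j, rfl⟩)))]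
      · exact hδr (by rw [Real.dist_eq, sub_zero, abs_of_pos (by linarith)]; linarith) j
    set u : Fin (m + 1) → Vec n := fun j => p + ε • (z j - p) with hu
    let L₀ : Matrix (Fin (m + 1)) (Fin (m + 1)) ℝ :=
      Matrix.of fun j i => (1 - ε) * l i + if j = i then ε else 0
    have hL₀ : ∀ j, u j = ∑ i, L₀ j i • z i := by
      intro j
      simp only [L₀, Matrix.of_apply, add_smul, Finset.sum_add_distrib, ite_smul, zero_smul,
        Finset.sum_ite_eq, Finset.mem_univ, if_true, mul_smul, ← Finset.smul_sum, ← hp, hu]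
      module
    have hdet : 0 < |L₀.det| :=
      abs_pos.2 (det_add_smul_one_ne_zero (hsum k z hface l hlB) hε)
    have hiter : ∀ N : ℕ, ∃ k, ∃ z : Fin (m + 1) → Vec n,
        ∃ L : Matrix (Fin (m + 1)) (Fin (m + 1)) ℝ, Function.Injective z ∧
          (∃ s ∈ (st k).simplices, Set.range z ⊆ s) ∧ (∀ j, u j = ∑ i, L j i • z i) ∧
          (∀ j i, 0 ≤ L j i) ∧ |L.det| = 2 ^ N * |L₀.det| := by
      intro N
      induction N with
      | zero =>
        exact ⟨k, z, L₀, hz, hface, hL₀,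
          fun j => hnonneg k z hz hface l (L₀ j) hl hlB (hL₀ j ▸ hεr j), by simp⟩
      | succ N ihN =>
        obtain ⟨k, z, L, hz, hface, hL, hL0, hdetL⟩ := ihN
        -- The face contains `u 0`, a point of the ball, so its vertices do not all share a
        -- solution.
        obtain ⟨a, b, hne⟩ : ∃ a b, solver (z a) ≠ solver (z b) := by
          by_contra! hall
          refine hunmixed k (Set.range z) hface ?_ (u 0) ?_ (hεr 0)
          · rintro _ ⟨a, rfl⟩ _ ⟨b, rfl⟩
            exact hall a b
          · rw [hL]
            exact (convex_convexHull ℝ _).sum_mem (fun i _ => hL0 0 i)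
              (hsum k z hface (L 0) (hL 0 ▸ hεr 0))
              fun i _ => subset_convexHull ℝ _ ⟨i, rfl⟩
        have hex : ∃ j ≥ k, ∃ a b, a ≠ b ∧ edgeMidpoint (sel j) = midpoint ℝ (z a) (z b) := by
          obtain ⟨s, hs, hzs⟩ := hface
          obtain ⟨j, hj, hm⟩ := hbisect k (z a) (z b) (fun h => hne (h ▸ rfl))
            ⟨s, hs, hzs ⟨a, rfl⟩, hzs ⟨b, rfl⟩⟩ hne
          exact ⟨j, hj, a, b, fun h => hne (h ▸ rfl), hm⟩
        clear hne a b
        obtain ⟨j, hfacej, a, b, hab, hm⟩ := h.exists_first_split hface hex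
        -- Replacing the vertex with the smaller coordinate keeps `u 0` in the new face; by
        -- `hnonneg` all other `u j` then lie in it too.
        wlog hle : L 0 a ≤ L 0 b generalizing a b
        · exact this b a hab.symm (by rw [midpoint_comm, hm]) (le_of_not_ge hle)
        have hz' : Function.Injective (Function.update z a (midpoint ℝ (z a) (z b))) := by
          obtain ⟨s, hs, hzs⟩ := hfacej
          exact injective_update_midpoint hz
            ((h.valid hn j).isProperSimplex s hs).linearIndepOn hzs hab
        have hface' : ∃ s ∈ (st (j + 1)).simplices,
            Set.range (Function.update z a (midpoint ℝ (z a) (z b))) ⊆ s := by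
          obtain ⟨s, hs, hzs⟩ := h.face_split hfacej ⟨a, rfl⟩ ⟨b, rfl⟩ (hz.ne hab) hm
          exact ⟨s, hs, (range_update_subset hz a _).trans hzs⟩
        have hL' : ∀ i, u i = ∑ c, bisectCoords a b (L i) c •
            Function.update z a (midpoint ℝ (z a) (z b)) c := fun i => by
          rw [sum_bisectCoords_smul hab, hL]
        refine ⟨j + 1, _, Matrix.of fun i => bisectCoords a b (L i), hz', hface', hL', ?_, ?_⟩
        · intro i
          refine hnonneg (j + 1) _ hz' hface' (bisectCoords a b (L 0)) _ (fun c => ?_)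
            (hL' 0 ▸ hεr 0) (hL' i ▸ hεr i)
          unfold bisectCoords
          split_ifs
          · exact mul_nonneg zero_le_two (hL0 0 a)
          · exact sub_nonneg.2 hle
          · exact hL0 0 c
        · rw [det_bisectCoords hab, abs_mul, hdetL, abs_of_pos (by norm_num : (0 : ℝ) < 2)]
          ring
    obtain ⟨N, hN⟩ := pow_unbounded_of_one_lt (((m + 1).factorial : ℝ) / |L₀.det|)
      (one_lt_two : (1 : ℝ) < 2)
    obtain ⟨k, z, L, hz, hface, hL, hL0, hdetL⟩ := hiter N
    have hbound := abs_det_le_factorial hL0 fun j => hsum k z hface (L j) (hL j ▸ hεr j)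
    rw [div_lt_iff₀ hdet, ← hdetL] at hN
    linarith

end AdaptiveSampling

/-! ### Completeness -/

namespace AdaptiveSampling

section Completeness

variable {n η : ℕ} {𝒯 : Type*} {Plan : 𝒯 → Type*}
  {cost : (T : 𝒯) → Plan T → Vec n} {I : Fin η → 𝒯} {policy : Vec n → (T : 𝒯) → Plan T}
  {fit : (Fin η → Vec n) → MeasureTheory.ProbabilityMeasure (Vec n)}
  {st : ℕ → State n η} {sel : ℕ → Sym2 (Vec n)}

lemma image_mrpd_subset (hpolicy : ∀ w ∈ weightSpace n, IsOptimal cost I w (policy w)) :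
    mrpd cost I policy '' weightSpace n ⊆ optimalSolutions cost I := by
  rintro _ ⟨w, hw, rfl⟩
  exact ⟨w, mem_optimalRegion_mrpd hpolicy hw⟩

/-- All points of a face whose vertices have the same solution have this solution, too. -/
lemma convexHull_subset_optimalRegion
    (hpolicy : ∀ w ∈ weightSpace n, IsOptimal cost I w (policy w)) {F : Set (Vec n)}
    (hF : F ⊆ weightSpace n) {C : Fin η → Vec n} (hFC : ∀ v ∈ F, mrpd cost I policy v = C) :
    convexHull ℝ F ⊆ optimalRegion cost I C :=
  convexHull_min (fun v hv => hFC v hv ▸ mem_optimalRegion_mrpd hpolicy (hF hv))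
    (convex_optimalRegion C)

/-- Every optimal solution is sampled. -/
theorem IsRun.exists_sampled (hn : 2 ≤ n)
    (hpolicy : ∀ w ∈ weightSpace n, IsOptimal cost I w (policy w))
    (hball : RegionsContainBall cost I) (h : IsRun fit 1 (mrpd cost I policy) st sel)
    (hbisect : ∀ k, ∀ e ∈ (st k).edges, Mixed (mrpd cost I policy) e →
      ∃ j ≥ k, edgeMidpoint (sel j) = edgeMidpoint e)
    {C : Fin η → Vec n} (hC : C ∈ optimalSolutions cost I) :
    ∃ k, ∃ w ∈ (st k).weights, mrpd cost I policy w = C := by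
  by_contra! hnever
  obtain ⟨w₀, hw₀, r, hr, hregion⟩ := hball C hC
  have hsub : ∀ k, ∀ s ∈ (st k).simplices, s ⊆ weightSpace n := fun k s hs =>
    ((h.valid hn k).subset_weights s hs).trans (h.valid hn k).weights_subset
  -- Applied to the initial simplex, where the barycentric coordinates of the centre `w₀` are its
  -- own entries.
  refine h.notMem_weightBall_of_not_sampled hn (w₀ := w₀) (r := r) ?_ ?_ n 0
    (fun i => EuclideanSpace.single i 1) ?_ ?_ w₀ hw₀.1 ?_
  · rintro k F ⟨s, hs, hFs⟩ hF w hw hwB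
    obtain ⟨v, hv⟩ := convexHull_nonempty_iff.1 ⟨w, hw⟩
    refine hnever k v ((h.valid hn k).subset_weights s hs (hFs hv)) ?_
    refine eq_of_mem_ball hregion hwB.1 hwB.2 ?_
    exact convexHull_subset_optimalRegion hpolicy (hFs.trans (hsub k s hs))
      (fun u hu => hF u hu v hv) hw
  · rintro k a b hab ⟨s, hs, ha, hb⟩ hne
    refine hbisect k s(a, b) ⟨s, hs, a, ha, b, hb, hab, rfl⟩ (mixed_mk.2 fun hmean => hne ?_)
    exact meanCost_injOn hball (image_mrpd_subset hpolicy ⟨a, hsub k s hs ha, rfl⟩)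
      (image_mrpd_subset hpolicy ⟨b, hsub k s hs hb, rfl⟩) hmean
  · intro i j hij
    exact (EuclideanSpace.basisFun (Fin n) ℝ).toBasis.injective (by simpa using hij)
  · rw [h.1]
    exact ⟨_, rfl, subset_rfl⟩
  · rw [← eq_sum_smul_basisWeight]
    exact ⟨hw₀.2, by simpa using hr⟩

end Completeness

end AdaptiveSampling

theorem theorem1 {n η : ℕ} (hn : 2 ≤ n) {𝒯 : Type*} {Plan : 𝒯 → Type*} [∀ T, Finite (Plan T)]
    (cost : (T : 𝒯) → Plan T → AdaptiveSampling.Vec n) (I : Fin η → 𝒯)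
    (policy : AdaptiveSampling.Vec n → (T : 𝒯) → Plan T)
    (hpolicy : ∀ w ∈ AdaptiveSampling.weightSpace n,
      AdaptiveSampling.IsOptimal cost I w (policy w))
    (hball : AdaptiveSampling.RegionsContainBall cost I)
    (fit : (Fin η → AdaptiveSampling.Vec n) →
      MeasureTheory.ProbabilityMeasure (AdaptiveSampling.Vec n)) :
    -- ties can be broken fairly
    (∃ st sel,
      AdaptiveSampling.IsRun fit 1 (AdaptiveSampling.mrpd cost I policy) st sel ∧
      AdaptiveSampling.FairTies fit 1 (AdaptiveSampling.mrpd cost I policy) st sel) ∧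
    ∀ st sel,
      AdaptiveSampling.IsRun fit 1 (AdaptiveSampling.mrpd cost I policy) st sel →
      AdaptiveSampling.FairTies fit 1 (AdaptiveSampling.mrpd cost I policy) st sel →
      -- completeness for a finite budget
      (∃ K₀ ≥ n, ∀ K ≥ K₀,
        (AdaptiveSampling.output st K).solutions = AdaptiveSampling.optimalSolutions cost I ∧
        ∀ C ∈ AdaptiveSampling.optimalSolutions cost I,
          ∃ w ∈ (AdaptiveSampling.output st K).weights,
            w ∈ AdaptiveSampling.optimalRegion cost I C ∧
            AdaptiveSampling.mrpd cost I policy w = C) ∧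
      -- every edge with different mean costs is expanded
      (∀ k, ∀ e ∈ (st k).edges,
        AdaptiveSampling.Mixed (AdaptiveSampling.mrpd cost I policy) e →
        ∃ j ≥ k, AdaptiveSampling.edgeMidpoint (sel j) = AdaptiveSampling.edgeMidpoint e) ∧
      -- a simplex is abandoned only if it holds one single solution, already sampled
      (∀ k, ∀ s, (∀ j ≥ k, s ∈ (st j).simplices) →
        ∃ C ∈ (st k).solutions,
          (∀ v ∈ s, AdaptiveSampling.mrpd cost I policy v = C) ∧
          (∀ w ∈ convexHull ℝ s, w ∈ AdaptiveSampling.optimalRegion cost I C) ∧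
          ∀ w ∈ intrinsicInterior ℝ (convexHull ℝ s), ∀ C',
            w ∈ AdaptiveSampling.optimalRegion cost I C' → C' = C) := by
  refine ⟨AdaptiveSampling.exists_isRun_fairTies hn, fun st sel hrun hfair => ?_⟩
  have himage := AdaptiveSampling.image_mrpd_subset (I := I) hpolicy
  have hbisect : ∀ k, ∀ e ∈ (st k).edges,
      AdaptiveSampling.Mixed (AdaptiveSampling.mrpd cost I policy) e →
      ∃ j ≥ k, AdaptiveSampling.edgeMidpoint (sel j) = AdaptiveSampling.edgeMidpoint e :=
    fun k e he hmix => hrun.exists_edgeMidpoint_eq hn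
      (AdaptiveSampling.finite_optimalSolutions.subset himage) hfair he hmix
  refine ⟨?_, hbisect, fun k s hs => ?_⟩
  · have hsampled : ∀ C ∈ AdaptiveSampling.optimalSolutions cost I, ∃ k,
        ∃ w ∈ (st k).weights, AdaptiveSampling.mrpd cost I policy w = C :=
      fun C hC => hrun.exists_sampled hn hpolicy hball hbisect hC
    choose! κ hκ using hsampled
    obtain ⟨M, hM⟩ := ((AdaptiveSampling.finite_optimalSolutions (cost := cost)
      (I := I)).image κ).bddAbove
    -- All solutions are sampled after `M` passes; the `n` basis weights count towards the budget.
    refine ⟨n + M, Nat.le_add_right n M, fun K hK => ?_⟩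
    have hv := hrun.valid hn (K - n)
    have hmem : ∀ C ∈ AdaptiveSampling.optimalSolutions cost I,
        ∃ w ∈ (st (K - n)).weights, AdaptiveSampling.mrpd cost I policy w = C := by
      intro C hC
      obtain ⟨w, hw, hwC⟩ := hκ C hC
      have hle : κ C ≤ M := hM ⟨C, hC, rfl⟩
      exact ⟨w, hrun.monotone_weights (by omega : κ C ≤ K - n) hw, hwC⟩
    refine ⟨?_, fun C hC => ?_⟩
    · refine hv.solutions_eq.trans (Set.Subset.antisymm ?_ hmem)
      exact (Set.image_mono hv.weights_subset).trans himage
    · obtain ⟨w, hw, rfl⟩ := hmem C hC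
      exact ⟨w, hw, AdaptiveSampling.mem_optimalRegion_mrpd hpolicy (hv.weights_subset hw), rfl⟩
  · have hv := hrun.valid hn k
    have hsk := hs k le_rfl
    obtain ⟨v, hvs⟩ := (hv.isProperSimplex s hsk).nontrivial.nonempty
    have hsame : ∀ u ∈ s, AdaptiveSampling.mrpd cost I policy u =
        AdaptiveSampling.mrpd cost I policy v := fun u hu =>
      hrun.solver_eq_of_forall_mem hn hbisect
        ((AdaptiveSampling.meanCost_injOn hball).mono himage) hs hu hvs
    have hsub := AdaptiveSampling.convexHull_subset_optimalRegion hpolicy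
      ((hv.subset_weights s hsk).trans hv.weights_subset) hsame
    refine ⟨_, ?_, hsame, fun w hw => hsub hw, fun w hw C' hC' =>
      AdaptiveSampling.eq_of_mem_intrinsicInterior (hv.isProperSimplex s hsk).span_eq_top
        hsub hw hC'⟩
    rw [hv.solutions_eq]
    exact ⟨v, hv.subset_weights s hsk hvs, rfl⟩
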